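/- Let $g\ge 0$ be an integer and let $\tau$ be a symmetric complex $g\times g$ matrix with positive definite imaginary part. For $\sigma\in(\mathbf Z/2\mathbf Z)^g$, represented by a vector in $\{0,1\}^g$, and $z\in\mathbf C^g$ (vectors are row vectors) put $$\Theta[\sigma](\tau,z):=\sum_{n\in\mathbf Z^g}\exp\bigl[\,2\pi i\,(n+\sigma/2)\,\tau\,{}^t(n+\sigma/2)+4\pi i\,(n+\sigma/2)\,{}^tz\,\bigr],\qquad \Theta_\tau(z):=\bigl(\Theta[\sigma](\tau,z)\bigr)_{\sigma}\in\mathbf C^{2^g}.$$ These are the second order theta functions $\theta[{}^\sigma_0](2\tau,2z)$ of $A_\tau=\mathbf C^g/(\mathbf Z^g+\mathbf Z^g\tau)$. Let the Heisenberg group act on $\mathbf C[\ldots,x_\sigma,\ldots]$, the polynomial ring in $2^g$ variables $x_\sigma$ with $\sigma\in(\mathbf Z/2\mathbf Z)^g$, as the group generated by the sign changes $x_\sigma\mapsto(-1)^{\sigma\,{}^t\alpha}x_\sigma$ and the translations $x_\sigma\mapsto x_{\sigma+\beta}$, where $\alpha,\beta\in(\mathbf Z/2\mathbf Z)^g$.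 **Proposition 2.5.** The vector $\Theta_\tau(0)$ is nonzero, so it defines a point of $\mathbf P^{2^g-1}$. Let $P$ be a homogeneous polynomial of degree $4$ (possibly zero) in the $x_\sigma$ that is invariant under the Heisenberg group. Then $P$ is an equation for the Kummer variety of $A_\tau$, i.e. $P(\Theta_\tau(z))=0$ for all $z\in\mathbf C^g$, if and only if the point $\Theta_\tau(0)$ is a singular point of the subscheme $P=0$ of $\mathbf P^{2^g-1}$, i.e. $P$ and all its partial derivatives $\partial P/\partial x_\sigma$ vanish at $\Theta_\tau(0)$ (for $P=0$ this condition is taken to define the term). -/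

import Mathlib

namespace KummerTheta

/-- The Siegel upper half space: symmetric complex `g × g` matrices with positive definite
imaginary part. -/
def SiegelUpperHalfSpace (g : ℕ) : Set (Matrix (Fin g) (Fin g) ℂ) :=
  {τ | τ.IsSymm ∧ (τ.map Complex.im).PosDef}

/-- The index set `(ℤ/2ℤ)^g` of characteristics and of the `2^g` coordinates. -/
abbrev Idx (g : ℕ) : Type := Fin g → ZMod 2

/-- Half of the representative in `{0,1}^g` of a class in `(ℤ/2ℤ)^g`, as a complex vector. -/
noncomputable def halfChar {g : ℕ} (ε : Idx g) : Fin g → ℂ :=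
  fun i => ((ε i).val : ℂ) / 2

/-- The classical theta function with characteristic
`θ[ε, ε'](τ, z) = ∑_{n ∈ ℤ^g} exp(π i (n + ε/2) τ ᵗ(n + ε/2) + 2 π i (n + ε/2) ᵗ(z + ε'/2))`.
The series converges absolutely for every `τ` in the Siegel upper half space. -/
noncomputable def theta {g : ℕ} (ε ε' : Idx g) (τ : Matrix (Fin g) (Fin g) ℂ)
    (z : Fin g → ℂ) : ℂ :=
  ∑' n : Fin g → ℤ,
    Complex.exp
      (Real.pi * Complex.I *
          (((fun i => (n i : ℂ)) + halfChar ε) ⬝ᵥ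
            (τ.mulVec ((fun i => (n i : ℂ)) + halfChar ε)))
        + 2 * Real.pi * Complex.I *
          (((fun i => (n i : ℂ)) + halfChar ε) ⬝ᵥ (z + halfChar ε')))

/-- The second order theta functions `Θ[σ](τ, z) = θ[σ, 0](2τ, 2z)`. -/
noncomputable def secondTheta {g : ℕ} (τ : Matrix (Fin g) (Fin g) ℂ) (z : Fin g → ℂ)
    (σ : Idx g) : ℂ :=
  theta σ 0 ((2 : ℂ) • τ) ((2 : ℂ) • z)

/-- The polynomial ring `ℂ[…, x_σ, …]` in `2^g` variables. -/
abbrev Poly (g : ℕ) : Type := MvPolynomial (Idx g) ℂ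

/-- The substitution `x_σ ↦ (-1)^{σ ᵗα} x_σ` as an algebra endomorphism. -/
noncomputable def signHom {g : ℕ} (α : Idx g) : Poly g →ₐ[ℂ] Poly g :=
  MvPolynomial.aeval fun σ => MvPolynomial.C ((-1 : ℂ) ^ (σ ⬝ᵥ α).val) * MvPolynomial.X σ

theorem signHom_comp_self {g : ℕ} (α : Idx g) :
    (signHom α).comp (signHom α) = AlgHom.id ℂ (Poly g) := by
  apply MvPolynomial.algHom_ext
  intro σ
  have h : ((-1 : ℂ) ^ (σ ⬝ᵥ α).val) * ((-1 : ℂ) ^ (σ ⬝ᵥ α).val) = 1 := by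
    rw [← mul_pow]; norm_num
  simp only [AlgHom.comp_apply, AlgHom.id_apply]
  simp only [signHom, MvPolynomial.aeval_X, map_mul, MvPolynomial.algHom_C,
    MvPolynomial.algebraMap_eq]
  rw [← mul_assoc, ← map_mul, h, map_one, one_mul]

/-- The sign change `x_σ ↦ (-1)^{σ ᵗα} x_σ`, an automorphism of the polynomial ring. -/
noncomputable def signChange {g : ℕ} (α : Idx g) : Poly g ≃ₐ[ℂ] Poly g :=
  AlgEquiv.ofAlgHom (signHom α) (signHom α) (signHom_comp_self α) (signHom_comp_self α)

/-- The translation `x_σ ↦ x_{σ+β}`, an automorphism of the polynomial ring. -/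
noncomputable def translation {g : ℕ} (β : Idx g) : Poly g ≃ₐ[ℂ] Poly g :=
  MvPolynomial.renameEquiv ℂ (Equiv.addRight β)

/-- The (finite) Heisenberg group in its action on polynomials in the `x_σ`: the group generated
by all sign changes and all translations. -/
noncomputable def heisenbergGroup (g : ℕ) : Subgroup (Poly g ≃ₐ[ℂ] Poly g) :=
  Subgroup.closure (Set.range signChange ∪ Set.range translation)

/-- Invariance under the Heisenberg group. -/
def IsHeisenbergInvariant {g : ℕ} (P : Poly g) : Prop :=
  ∀ h ∈ heisenbergGroup g, h P = P

/-- `P` is an equation for the Kummer variety of `A_τ = ℂ^g / (ℤ^g + ℤ^g τ)`: the function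
`(Θ_τ^* P)(z)`, obtained by substituting `x_σ := Θ[σ](τ, z)` in `P`, vanishes identically
on `ℂ^g`. -/
def IsKummerEquation {g : ℕ} (τ : Matrix (Fin g) (Fin g) ℂ) (P : Poly g) : Prop :=
  ∀ z : Fin g → ℂ, MvPolynomial.eval (secondTheta τ z) P = 0

/-- The projective space `ℙ^{2^g - 1}` with homogeneous coordinates `x_σ`. -/
abbrev ProjSpace (g : ℕ) : Type := Projectivization ℂ (Idx g → ℂ)

/-- `p` is a singular point of the subscheme `P = 0` of projective space, for a homogeneous
polynomial `P`: the polynomial and all its first order partial derivatives vanish at `p`, that is,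
at all the vectors of homogeneous coordinates of `p`. -/
def IsSingularPoint {g : ℕ} (P : Poly g) (p : ProjSpace g) : Prop :=
  ∀ (v : Idx g → ℂ) (hv : v ≠ 0), Projectivization.mk ℂ v hv = p →
    MvPolynomial.eval v P = 0 ∧
      ∀ σ : Idx g, MvPolynomial.eval v (MvPolynomial.pderiv σ P) = 0

end KummerTheta

/-! ### Absolute convergence and uniqueness of Fourier coefficients. -/

namespace KummerTheta

/-! Everything follows from one identity for invariant quartics, `four_mul_eval_secondTheta`: 4
P(Θ(z)) = Σ_σ Θ[σ](2z) ∂_σP(Θ(0)). If the partial derivatives vanish at Θ(0), so does P(Θ(z)).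
Conversely, if P(Θ(z)) is identically zero, linear independence of the Θ[σ]
(`secondTheta_linearIndependent`) kills every derivative.

Both sides are linear in P, so averages of monomials over the Heisenberg group suffice. Averaging
over signs kills x_a x_b x_c x_d unless a+b+c+d = 0; for the remaining monomials, the sum over
translations satisfies the identity by `riemann_relation`, applied once to each of the four terms of
the product rule. That relation comes from a half-integral orthogonal involution acting on
quadruples of lattice vectors.

The point Θ(0) is nonzero because Σ_σ Θ[σ](0) Θ[σ](w) is the square of Riemann's theta function
(`sum_secondTheta_zero_mul`), which is not identically zero. This and the linear independence rest
on uniqueness of Fourier coefficients. -/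

theorem summable_prod_pi : ∀ {g : ℕ} (f : Fin g → ℤ → ℝ), (∀ i n, 0 ≤ f i n) →
    (∀ i, Summable (f i)) → Summable fun N : Fin g → ℤ => ∏ i, f i (N i)
  | 0, _, _, _ => Summable.of_finite
  | g + 1, f, h0, hf => by
    rw [← (Fin.consEquiv (fun _ : Fin (g + 1) => ℤ)).summable_iff]
    have ih := summable_prod_pi (fun i => f i.succ) (fun i => h0 _) (fun i => hf _)
    refine ((hf 0).mul_of_nonneg ih (h0 0)
      (fun N => Finset.prod_nonneg fun i _ => h0 _ _)).congr fun x => ?_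
    simp [Fin.prod_univ_succ, Fin.consEquiv]

theorem summable_exp_neg_sq_add {A : ℝ} (hA : 0 < A) (B : ℝ) :
    Summable fun n : ℤ => Real.exp (-A * (n : ℝ) ^ 2 + B * n) := by
  -- At these purely imaginary arguments the norm of the Jacobi theta term is exactly the required
  -- real exponential.
  have h := ((summable_jacobiTheta₂_term_iff ((-B / (2 * Real.pi) : ℝ) * Complex.I)
    ((A / Real.pi : ℝ) * Complex.I)).2 (by simpa using div_pos hA Real.pi_pos)).norm
  refine h.congr fun n => ?_
  rw [norm_jacobiTheta₂_term]
  congr 1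
  simp only [Complex.mul_I_im, Complex.ofReal_re]
  field_simp
  ring

/-- The constant is the minimum of the quadratic form on the compact Euclidean unit sphere;
homogeneity does the rest. -/
theorem exists_sum_sq_le_of_posDef {g : ℕ} {M : Matrix (Fin g) (Fin g) ℝ} (hM : M.PosDef) :
    ∃ c > 0, ∀ x : Fin g → ℝ, c * ∑ i, x i ^ 2 ≤ x ⬝ᵥ M.mulVec x := by
  have hK : IsCompact {x : Fin g → ℝ | ∑ i, x i ^ 2 = 1} := by
    refine (isCompact_closedBall (0 : Fin g → ℝ) 1).of_isClosed_subset
      (isClosed_eq (by fun_prop) continuous_const) fun x hx => ?_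
    rw [mem_closedBall_zero_iff, pi_norm_le_iff_of_nonneg zero_le_one]
    intro i
    have : x i ^ 2 ≤ 1 := by
      rw [← (show ∑ i, x i ^ 2 = 1 from hx)]
      exact Finset.single_le_sum (f := fun i => x i ^ 2) (fun i _ => sq_nonneg _)
        (Finset.mem_univ i)
    simpa using abs_le_one_iff_mul_self_le_one.2 (by nlinarith)
  have hcont : Continuous fun x : Fin g → ℝ => x ⬝ᵥ M.mulVec x := by
    simp only [dotProduct, Matrix.mulVec]
    fun_prop
  have main : ∃ c > 0, ∀ x ∈ {x : Fin g → ℝ | ∑ i, x i ^ 2 = 1}, c ≤ x ⬝ᵥ M.mulVec x := by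
    -- The sphere is empty when g = 0.
    rcases Set.eq_empty_or_nonempty {x : Fin g → ℝ | ∑ i, x i ^ 2 = 1} with h | h
    · exact ⟨1, one_pos, by simp [h]⟩
    · obtain ⟨y, hy, hmin⟩ := hK.exists_isMinOn h hcont.continuousOn
      refine ⟨y ⬝ᵥ M.mulVec y, ?_, fun x hx => hmin hx⟩
      have hy0 : y ≠ 0 := by
        rintro rfl
        simp at hy
      simpa using hM.dotProduct_mulVec_pos hy0
  obtain ⟨c, hc, h⟩ := main
  refine ⟨c, hc, fun x => ?_⟩
  have hnn : 0 ≤ ∑ i, x i ^ 2 := Finset.sum_nonneg fun i _ => sq_nonneg _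
  rcases hnn.eq_or_lt with h0 | h0
  · rw [← h0, mul_zero]
    simpa using hM.posSemidef.dotProduct_mulVec_nonneg x
  · set s := ∑ i, x i ^ 2 with hs
    have hr : (Real.sqrt s)⁻¹ * (Real.sqrt s)⁻¹ = s⁻¹ := by
      rw [← mul_inv, Real.mul_self_sqrt hnn]
    have := h ((Real.sqrt s)⁻¹ • x) (by
      simp only [Set.mem_ofPred_eq, Pi.smul_apply, smul_eq_mul, mul_pow, ← Finset.mul_sum, ← hs]
      rw [sq, hr, inv_mul_cancel₀ h0.ne'])
    rw [Matrix.mulVec_smul, smul_dotProduct, dotProduct_smul, smul_smul, hr, smul_eq_mul,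
      inv_mul_eq_div, le_div_iff₀ h0] at this
    exact this

/-- The exponential `exp(π i / 2 · N τ ᵗN + 2 π i N ᵗz)`; the second order theta functions are the
sums of these over the residue classes of `N` modulo `2`. -/
noncomputable def expTerm {g : ℕ} (τ : Matrix (Fin g) (Fin g) ℂ) (z : Fin g → ℂ)
    (N : Fin g → ℤ) : ℂ :=
  Complex.exp (Real.pi * Complex.I / 2 *
      ((fun i => (N i : ℂ)) ⬝ᵥ τ.mulVec (fun i => (N i : ℂ)))
    + 2 * Real.pi * Complex.I * ((fun i => (N i : ℂ)) ⬝ᵥ z))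

theorem summable_norm_expTerm {g : ℕ} {τ : Matrix (Fin g) (Fin g) ℂ}
    (hτ : (τ.map Complex.im).PosDef) (z : Fin g → ℂ) :
    Summable fun N => ‖expTerm τ z N‖ := by
  obtain ⟨c, hc, h⟩ := exists_sum_sq_le_of_posDef hτ
  have hs := summable_prod_pi
    (fun i n => Real.exp (-(Real.pi / 2 * c) * (n : ℝ) ^ 2 + (-(2 * Real.pi * (z i).im)) * n))
    (fun i n => (Real.exp_pos _).le)
    (fun i => summable_exp_neg_sq_add (by positivity) _)
  refine hs.of_nonneg_of_le (fun _ => norm_nonneg _) fun N => ?_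
  rw [expTerm, Complex.norm_exp, ← Real.exp_sum, Real.exp_le_exp]
  have h1 : ((fun i => (N i : ℂ)) ⬝ᵥ τ.mulVec (fun i => (N i : ℂ))).im =
      (fun i => (N i : ℝ)) ⬝ᵥ (τ.map Complex.im).mulVec (fun i => (N i : ℝ)) := by
    simp [dotProduct, Matrix.mulVec, Complex.im_sum]
  have h2 : ((fun i => (N i : ℂ)) ⬝ᵥ z).im = ∑ i, (N i : ℝ) * (z i).im := by
    simp [dotProduct, Complex.im_sum]
  have h3 : ∀ w : ℂ, (Real.pi * Complex.I / 2 * w).re = -(Real.pi / 2) * w.im := fun w => by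
    rw [show Real.pi * Complex.I / 2 * w = ((Real.pi / 2 : ℝ) : ℂ) * (Complex.I * w) by
      push_cast; ring, Complex.re_ofReal_mul]
    simp
  have h4 : ∀ w : ℂ, (2 * Real.pi * Complex.I * w).re = -(2 * Real.pi) * w.im := fun w => by
    rw [show 2 * Real.pi * Complex.I * w = ((2 * Real.pi : ℝ) : ℂ) * (Complex.I * w) by
      push_cast; ring, Complex.re_ofReal_mul]
    simp
  rw [Complex.add_re, h3, h4, h1, h2, Finset.sum_add_distrib, ← Finset.mul_sum]
  have h5 := mul_le_mul_of_nonneg_left (h fun i => (N i : ℝ)) (by positivity : 0 ≤ Real.pi / 2)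
  have h6 : ∑ i, -(2 * Real.pi * (z i).im) * (N i : ℝ) =
      -(2 * Real.pi) * ∑ i, (N i : ℝ) * (z i).im := by
    rw [Finset.mul_sum]
    exact Finset.sum_congr rfl fun i _ => by ring
  rw [h6]
  linarith

/-- The functional is the L² pairing with the m-th monomial; its continuity in the sup norm lets it
pass through uniformly convergent series. -/
theorem exists_fourier_coefficient_functional {g : ℕ} (m : Fin g → ℤ) :
    ∃ L : C(UnitAddTorus (Fin g), ℂ) →L[ℂ] ℂ,
      ∀ n, L (UnitAddTorus.mFourier n) = if m = n then 1 else 0 := by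
  -- Orthonormality of the monomials needs Haar measure of total mass 1.
  let _ : MeasureTheory.MeasureSpace UnitAddCircle := ⟨AddCircle.haarAddCircle⟩
  have : MeasureTheory.IsProbabilityMeasure
      (MeasureTheory.volume : MeasureTheory.Measure UnitAddCircle) :=
    inferInstanceAs (MeasureTheory.IsProbabilityMeasure AddCircle.haarAddCircle)
  refine ⟨(innerSL ℂ (UnitAddTorus.mFourierLp 2 m)).comp
    (ContinuousMap.toLp (E := ℂ) 2 MeasureTheory.volume ℂ), fun n => ?_⟩
  exact orthonormal_iff_ite.1 (UnitAddTorus.orthonormal_mFourier (d := Fin g)) m n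

theorem eq_zero_of_fourier_series_eq_zero {g : ℕ} {a : (Fin g → ℤ) → ℂ}
    (ha : Summable fun N => ‖a N‖)
    (h : ∀ x : Fin g → ℝ, ∑' N, a N *
      Complex.exp (2 * Real.pi * Complex.I * ((fun i => (N i : ℂ)) ⬝ᵥ fun i => (x i : ℂ))) = 0) :
    a = 0 := by
  have hs : Summable fun N => a N • UnitAddTorus.mFourier N :=
    Summable.of_norm (by simpa [norm_smul, UnitAddTorus.mFourier_norm] using ha)
  have h0 : HasSum (fun N => a N • UnitAddTorus.mFourier N) 0 := by
    convert hs.hasSum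
    symm
    ext t
    obtain ⟨x, rfl⟩ : ∃ x : Fin g → ℝ, (fun i => (x i : UnitAddCircle)) = t :=
      ⟨fun i => (QuotientAddGroup.mk_surjective (t i)).choose,
        funext fun i => (QuotientAddGroup.mk_surjective (t i)).choose_spec⟩
    rw [← ContinuousMap.tsum_apply hs, ContinuousMap.zero_apply, ← h x]
    refine tsum_congr fun N => ?_
    simp only [ContinuousMap.smul_apply, smul_eq_mul, UnitAddTorus.mFourier, ContinuousMap.coe_mk,
      fourier_coe_apply, ← Complex.exp_sum, dotProduct, Finset.mul_sum]
    congr 2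
    exact Finset.sum_congr rfl fun i _ => by push_cast; ring
  funext m
  obtain ⟨L, hL⟩ := exists_fourier_coefficient_functional m
  have h1 := h0.mapL L
  rw [map_zero] at h1
  refine HasSum.unique ?_ h1
  simp only [map_smul, hL, smul_eq_mul, mul_ite, mul_one, mul_zero]
  convert hasSum_ite_eq m (a m) using 2 with N
  by_cases hN : m = N
  · simp [hN]
  · simp [hN, Ne.symm hN]

end KummerTheta

/-! ### Riemann's theta relation. -/

namespace KummerTheta

/-- The residue class modulo `2` of an integer vector. -/
def parity {g : ℕ} (N : Fin g → ℤ) : Idx g := fun i => (N i : ZMod 2)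

open Classical in
/-- The restriction of `expTerm` to the residue class `σ` modulo `2`. -/
noncomputable def residueTerm {g : ℕ} (τ : Matrix (Fin g) (Fin g) ℂ) (z : Fin g → ℂ) (σ : Idx g)
    (N : Fin g → ℤ) : ℂ :=
  if parity N = σ then expTerm τ z N else 0

section

variable {g : ℕ} {τ : Matrix (Fin g) (Fin g) ℂ}

/-- Substitute N = 2n + σ, so that n + σ/2 = N/2. -/
theorem secondTheta_eq_tsum (z : Fin g → ℂ) (σ : Idx g) :
    secondTheta τ z σ = ∑' N, residueTerm τ z σ N := by
  have hinj : Function.Injective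
      fun (n : Fin g → ℤ) => fun i => 2 * n i + ((σ i).val : ℤ) := fun m n h => by
    funext i
    have := congrFun h i
    simp only at this
    omega
  have hpar : ∀ n : Fin g → ℤ, parity (fun i => 2 * n i + ((σ i).val : ℤ)) = σ := fun n => by
    funext i
    have h2 : (2 : ZMod 2) = 0 := rfl
    simp [parity, h2]
  rw [← hinj.tsum_eq (f := residueTerm τ z σ)]
  · rw [secondTheta, theta]
    refine tsum_congr fun n => ?_
    rw [residueTerm, if_pos (hpar n), expTerm]
    have hv : (fun i => ((2 * n i + ((σ i).val : ℤ) : ℤ) : ℂ)) =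
        (2 : ℂ) • ((fun i => (n i : ℂ)) + halfChar σ) := by
      funext i
      simp [halfChar]
      ring
    have h0 : halfChar (0 : Idx g) = 0 := by
      funext i
      simp [halfChar]
    rw [hv, h0, add_zero]
    simp only [Matrix.smul_mulVec, Matrix.mulVec_smul, smul_dotProduct, dotProduct_smul,
      smul_eq_mul]
    congr 1
    ring
  · intro N hN
    have h : parity N = σ := by
      by_contra h
      simp [residueTerm, h] at hN
    refine ⟨fun i => (N i - ((σ i).val : ℤ)) / 2, ?_⟩
    funext i
    have h1 : (((N i - ((σ i).val : ℤ)) : ℤ) : ZMod 2) = 0 := by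
      have := congrFun h i
      simp only [parity] at this
      simp [this]
    have h2 := (ZMod.intCast_zmod_eq_zero_iff_dvd _ 2).1 h1
    simp only
    omega

theorem summable_norm_residueTerm (hτ : (τ.map Complex.im).PosDef) (z : Fin g → ℂ) (σ : Idx g) :
    Summable fun N => ‖residueTerm τ z σ N‖ := by
  refine (summable_norm_expTerm hτ z).of_nonneg_of_le (fun _ => norm_nonneg _) fun N => ?_
  rw [residueTerm]
  split_ifs <;> simp

theorem hasSum_mul_four {ι : Type*} {f₁ f₂ f₃ f₄ : ι → ℂ} (h₁ : Summable fun x => ‖f₁ x‖)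
    (h₂ : Summable fun x => ‖f₂ x‖) (h₃ : Summable fun x => ‖f₃ x‖)
    (h₄ : Summable fun x => ‖f₄ x‖) :
    HasSum (fun p : (ι × ι) × (ι × ι) => f₁ p.1.1 * f₂ p.1.2 * (f₃ p.2.1 * f₄ p.2.2))
      ((∑' x, f₁ x) * (∑' x, f₂ x) * ((∑' x, f₃ x) * ∑' x, f₄ x)) := by
  have h12 := h₁.mul_norm h₂
  have h34 := h₃.mul_norm h₄
  rw [tsum_mul_tsum_of_summable_norm h₁ h₂, tsum_mul_tsum_of_summable_norm h₃ h₄,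
    tsum_mul_tsum_of_summable_norm h12 h34]
  exact (summable_mul_of_summable_norm h12 h34).hasSum

/-- The quadruples of integer vectors whose residue classes modulo `2` are a common translate of
`(a, b, c, d)`. -/
def quadrupleSet (a b c d : Idx g) :
    Set (((Fin g → ℤ) × (Fin g → ℤ)) × ((Fin g → ℤ) × (Fin g → ℤ))) :=
  {p | parity (p.1.1 + p.1.2) = a + b ∧ parity (p.1.1 + p.2.1) = a + c ∧
    parity (p.1.1 + p.2.2) = a + d}

theorem parity_add_eq_iff (M N : Fin g → ℤ) (a b : Idx g) :
    parity (M + N) = a + b ↔ parity N = b + (parity M + a) := by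
  simp only [funext_iff, parity, Pi.add_apply, Int.cast_add]
  refine forall_congr' fun i => ?_
  generalize (M i : ZMod 2) = x
  generalize (N i : ZMod 2) = y
  generalize a i = u
  generalize b i = v
  revert x y u v
  decide

theorem eq_add_iff_eq_add (x a β : Idx g) : x = a + β ↔ β = x + a := by
  simp only [funext_iff, Pi.add_apply]
  refine forall_congr' fun i => ?_
  generalize x i = p
  generalize a i = q
  generalize β i = r
  revert p q r
  decide

open Classical in
-- The first factor forces β = `parity p.1.1 + a`, so at most one summand survives; the other three
-- factors then test membership in `quadrupleSet`.
theorem sum_residueTerm_mul_four (z₁ z₂ z₃ z₄ : Fin g → ℂ) (a b c d : Idx g)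
    (p : ((Fin g → ℤ) × (Fin g → ℤ)) × ((Fin g → ℤ) × (Fin g → ℤ))) :
    ∑ β, residueTerm τ z₁ (a + β) p.1.1 * residueTerm τ z₂ (b + β) p.1.2 *
      (residueTerm τ z₃ (c + β) p.2.1 * residueTerm τ z₄ (d + β) p.2.2) =
    (quadrupleSet a b c d).indicator (fun p => expTerm τ z₁ p.1.1 * expTerm τ z₂ p.1.2 *
      (expTerm τ z₃ p.2.1 * expTerm τ z₄ p.2.2)) p := by
  rw [Finset.sum_eq_single (parity p.1.1 + a)]
  · simp only [residueTerm, Set.indicator, quadrupleSet, Set.mem_ofPred_eq, parity_add_eq_iff]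
    rw [if_pos ((eq_add_iff_eq_add _ _ _).2 rfl)]
    by_cases h2 : parity p.1.2 = b + (parity p.1.1 + a) <;>
    by_cases h3 : parity p.2.1 = c + (parity p.1.1 + a) <;>
    by_cases h4 : parity p.2.2 = d + (parity p.1.1 + a) <;>
    simp [h2, h3, h4]
  · intro β _ hβ
    rw [residueTerm, if_neg (fun h => hβ ((eq_add_iff_eq_add _ _ _).1 h))]
    simp
  · simp

theorem sum_secondTheta_mul_four (hτ : (τ.map Complex.im).PosDef) (z₁ z₂ z₃ z₄ : Fin g → ℂ)
    (a b c d : Idx g) :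
    ∑ β, secondTheta τ z₁ (a + β) * secondTheta τ z₂ (b + β) *
      (secondTheta τ z₃ (c + β) * secondTheta τ z₄ (d + β)) =
    ∑' p : quadrupleSet a b c d, expTerm τ z₁ p.1.1.1 * expTerm τ z₂ p.1.1.2 *
      (expTerm τ z₃ p.1.2.1 * expTerm τ z₄ p.1.2.2) := by
  have h := hasSum_sum (s := Finset.univ) fun β (_ : β ∈ Finset.univ) =>
    hasSum_mul_four (summable_norm_residueTerm hτ z₁ (a + β))
      (summable_norm_residueTerm hτ z₂ (b + β)) (summable_norm_residueTerm hτ z₃ (c + β))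
      (summable_norm_residueTerm hτ z₄ (d + β))
  simp only [sum_residueTerm_mul_four, ← secondTheta_eq_tsum] at h
  rw [← h.tsum_eq, ← tsum_subtype (quadrupleSet a b c d) fun p =>
    expTerm τ z₁ p.1.1 * expTerm τ z₂ p.1.2 * (expTerm τ z₃ p.2.1 * expTerm τ z₄ p.2.2)]

/-- The orthogonal involution of `ℚ⁴` that underlies Riemann's theta relation, applied to a
quadruple of integer vectors. -/
def riemannMap (p : ((Fin g → ℤ) × (Fin g → ℤ)) × ((Fin g → ℤ) × (Fin g → ℤ))) :
    ((Fin g → ℤ) × (Fin g → ℤ)) × ((Fin g → ℤ) × (Fin g → ℤ)) :=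
  ((fun i => (p.1.1 i + p.1.2 i + p.2.1 i + p.2.2 i) / 2,
    fun i => (p.1.1 i + p.1.2 i - p.2.1 i - p.2.2 i) / 2),
   (fun i => (p.1.1 i - p.1.2 i + p.2.1 i - p.2.2 i) / 2,
    fun i => (p.1.1 i - p.1.2 i - p.2.1 i + p.2.2 i) / 2))

/-- This makes all the integer divisions by 2 in `riemannMap` exact, since the other three
numerators have the same parity. -/
theorem two_dvd_of_mem_quadrupleSet {a b c d : Idx g} (h : a + b + c + d = 0)
    {p : ((Fin g → ℤ) × (Fin g → ℤ)) × ((Fin g → ℤ) × (Fin g → ℤ))}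
    (hp : p ∈ quadrupleSet a b c d) (i : Fin g) :
    2 ∣ p.1.1 i + p.1.2 i + p.2.1 i + p.2.2 i := by
  refine (ZMod.intCast_zmod_eq_zero_iff_dvd _ 2).1 ?_
  have h1 := congrFun hp.1 i
  have h2 := congrFun hp.2.1 i
  have h3 := congrFun hp.2.2 i
  have h0 := congrFun h i
  have two : (2 : ZMod 2) = 0 := rfl
  simp only [parity, Pi.add_apply, Int.cast_add, Pi.zero_apply] at h0 h1 h2 h3
  push_cast
  linear_combination h1 + h2 + h3 + h0 + (a i - (p.1.1 i : ZMod 2)) * two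

/-- The map leaves N₁+N₂, N₁+N₃ and N₁+N₄ unchanged, and these define the set. -/
theorem riemannMap_mem {a b c d : Idx g} (h : a + b + c + d = 0)
    {p : ((Fin g → ℤ) × (Fin g → ℤ)) × ((Fin g → ℤ) × (Fin g → ℤ))}
    (hp : p ∈ quadrupleSet a b c d) : riemannMap p ∈ quadrupleSet a b c d := by
  have hd := two_dvd_of_mem_quadrupleSet h hp
  refine ⟨Eq.trans ?_ hp.1, Eq.trans ?_ hp.2.1, Eq.trans ?_ hp.2.2⟩ <;>
  · congr 1
    funext i
    have := hd i
    simp only [riemannMap, Pi.add_apply]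
    omega

theorem riemannMap_riemannMap {a b c d : Idx g} (h : a + b + c + d = 0)
    {p : ((Fin g → ℤ) × (Fin g → ℤ)) × ((Fin g → ℤ) × (Fin g → ℤ))}
    (hp : p ∈ quadrupleSet a b c d) : riemannMap (riemannMap p) = p := by
  have hd := two_dvd_of_mem_quadrupleSet h hp
  refine Prod.ext (Prod.ext ?_ ?_) (Prod.ext ?_ ?_) <;>
  · funext i
    have := hd i
    simp only [riemannMap]
    omega

/-- Orthogonality preserves the sum of the four quadratic terms, and N₁+N₂+N₃+N₄ is twice the first
new vector, which moves the whole linear term to 2z. -/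
theorem expTerm_mul_four_riemannMap {a b c d : Idx g} (h : a + b + c + d = 0)
    {p : ((Fin g → ℤ) × (Fin g → ℤ)) × ((Fin g → ℤ) × (Fin g → ℤ))}
    (hp : p ∈ quadrupleSet a b c d) (z : Fin g → ℂ) :
    expTerm τ ((2 : ℂ) • z) (riemannMap p).1.1 * expTerm τ 0 (riemannMap p).1.2 *
      (expTerm τ 0 (riemannMap p).2.1 * expTerm τ 0 (riemannMap p).2.2) =
    expTerm τ z p.1.1 * expTerm τ z p.1.2 * (expTerm τ z p.2.1 * expTerm τ z p.2.2) := by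
  have hd := two_dvd_of_mem_quadrupleSet h hp
  obtain ⟨⟨N₁, N₂⟩, N₃, N₄⟩ := p
  simp only at hd
  have e1 : (fun i => ((riemannMap ((N₁, N₂), (N₃, N₄))).1.1 i : ℂ)) =
      (1 / 2 : ℂ) • ((fun i => (N₁ i : ℂ)) + (fun i => (N₂ i : ℂ)) + (fun i => (N₃ i : ℂ)) +
        fun i => (N₄ i : ℂ)) := by
    funext i
    have : 2 * (riemannMap ((N₁, N₂), (N₃, N₄))).1.1 i = N₁ i + N₂ i + N₃ i + N₄ i := by
      have := hd i
      simp only [riemannMap]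
      omega
    have := congrArg (Int.cast : ℤ → ℂ) this
    push_cast at this
    simp only [Pi.smul_apply, Pi.add_apply, smul_eq_mul]
    linear_combination this / 2
  have e2 : (fun i => ((riemannMap ((N₁, N₂), (N₃, N₄))).1.2 i : ℂ)) =
      (1 / 2 : ℂ) • ((fun i => (N₁ i : ℂ)) + (fun i => (N₂ i : ℂ)) - (fun i => (N₃ i : ℂ)) -
        fun i => (N₄ i : ℂ)) := by
    funext i
    have : 2 * (riemannMap ((N₁, N₂), (N₃, N₄))).1.2 i = N₁ i + N₂ i - N₃ i - N₄ i := by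
      have := hd i
      simp only [riemannMap]
      omega
    have := congrArg (Int.cast : ℤ → ℂ) this
    push_cast at this
    simp only [Pi.smul_apply, Pi.add_apply, Pi.sub_apply, smul_eq_mul]
    linear_combination this / 2
  have e3 : (fun i => ((riemannMap ((N₁, N₂), (N₃, N₄))).2.1 i : ℂ)) =
      (1 / 2 : ℂ) • ((fun i => (N₁ i : ℂ)) - (fun i => (N₂ i : ℂ)) + (fun i => (N₃ i : ℂ)) -
        fun i => (N₄ i : ℂ)) := by
    funext i
    have : 2 * (riemannMap ((N₁, N₂), (N₃, N₄))).2.1 i = N₁ i - N₂ i + N₃ i - N₄ i := by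
      have := hd i
      simp only [riemannMap]
      omega
    have := congrArg (Int.cast : ℤ → ℂ) this
    push_cast at this
    simp only [Pi.smul_apply, Pi.add_apply, Pi.sub_apply, smul_eq_mul]
    linear_combination this / 2
  have e4 : (fun i => ((riemannMap ((N₁, N₂), (N₃, N₄))).2.2 i : ℂ)) =
      (1 / 2 : ℂ) • ((fun i => (N₁ i : ℂ)) - (fun i => (N₂ i : ℂ)) - (fun i => (N₃ i : ℂ)) +
        fun i => (N₄ i : ℂ)) := by
    funext i
    have : 2 * (riemannMap ((N₁, N₂), (N₃, N₄))).2.2 i = N₁ i - N₂ i - N₃ i + N₄ i := by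
      have := hd i
      simp only [riemannMap]
      omega
    have := congrArg (Int.cast : ℤ → ℂ) this
    push_cast at this
    simp only [Pi.smul_apply, Pi.add_apply, Pi.sub_apply, smul_eq_mul]
    linear_combination this / 2
  simp only [expTerm, e1, e2, e3, e4, ← Complex.exp_add]
  simp only [Matrix.mulVec_smul, Matrix.mulVec_add, Matrix.mulVec_sub, smul_dotProduct,
    dotProduct_smul, add_dotProduct, sub_dotProduct, dotProduct_add, dotProduct_sub, smul_eq_mul,
    dotProduct_zero]
  congr 1
  ring

/-- **Riemann's theta relation** for second order theta functions, at the arguments `(z, z, z, z)`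
and `(2z, 0, 0, 0)`. -/
theorem riemann_relation (hτ : (τ.map Complex.im).PosDef) (z : Fin g → ℂ) {a b c d : Idx g}
    (h : a + b + c + d = 0) :
    ∑ β, secondTheta τ z (a + β) * secondTheta τ z (b + β) *
      (secondTheta τ z (c + β) * secondTheta τ z (d + β)) =
    ∑ β, secondTheta τ ((2 : ℂ) • z) (a + β) * secondTheta τ 0 (b + β) *
      (secondTheta τ 0 (c + β) * secondTheta τ 0 (d + β)) := by
  rw [sum_secondTheta_mul_four hτ, sum_secondTheta_mul_four hτ]
  let e : quadrupleSet a b c d ≃ quadrupleSet a b c d :=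
    { toFun := fun p => ⟨riemannMap p.1, riemannMap_mem h p.2⟩
      invFun := fun p => ⟨riemannMap p.1, riemannMap_mem h p.2⟩
      left_inv := fun p => Subtype.ext (riemannMap_riemannMap h p.2)
      right_inv := fun p => Subtype.ext (riemannMap_riemannMap h p.2) }
  refine Eq.trans ?_ (e.tsum_eq _)
  exact tsum_congr fun p => (expTerm_mul_four_riemannMap h p.2 z).symm

end

end KummerTheta

/-! ### Linear independence and nonvanishing at the origin. -/

namespace KummerTheta

section

variable {g : ℕ} {τ : Matrix (Fin g) (Fin g) ℂ}

theorem expTerm_ofReal (x : Fin g → ℝ) (N : Fin g → ℤ) :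
    expTerm τ (fun i => (x i : ℂ)) N = expTerm τ 0 N *
      Complex.exp (2 * Real.pi * Complex.I * ((fun i => (N i : ℂ)) ⬝ᵥ fun i => (x i : ℂ))) := by
  rw [expTerm, expTerm, ← Complex.exp_add, dotProduct_zero, mul_zero, add_zero]

theorem parity_val (σ : Idx g) : parity (fun i => ((σ i).val : ℤ)) = σ := by
  funext i
  simp [parity]

/-- Distinct characteristics have disjoint Fourier supports: the coefficient at N is `c (parity N)`
times an exponential. -/
theorem secondTheta_linearIndependent (hτ : (τ.map Complex.im).PosDef) {c : Idx g → ℂ}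
    (h : ∀ w : Fin g → ℂ, ∑ σ, c σ * secondTheta τ w σ = 0) : c = 0 := by
  have hs : ∀ (w : Fin g → ℂ), HasSum (fun N => c (parity N) * expTerm τ w N) 0 := fun w => by
    have h1 := hasSum_sum (s := Finset.univ) fun σ (_ : σ ∈ Finset.univ) =>
      ((summable_norm_residueTerm hτ w σ).of_norm.hasSum.mul_left (c σ))
    simp only [← secondTheta_eq_tsum, h] at h1
    refine h1.congr_fun fun N => ?_
    rw [Finset.sum_eq_single (parity N)]
    · simp [residueTerm]
    · intro σ _ hσ
      simp [residueTerm, hσ.symm]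
    · simp
  have h0 := eq_zero_of_fourier_series_eq_zero (a := fun N => c (parity N) * expTerm τ 0 N)
    (hs 0).summable.norm fun x => by
      rw [← (hs fun i => (x i : ℂ)).tsum_eq]
      exact tsum_congr fun N => by rw [expTerm_ofReal, mul_assoc]
  funext σ
  have := congrFun h0 fun i => ((σ i).val : ℤ)
  simp only [parity_val, Pi.zero_apply] at this
  exact (mul_eq_zero.1 this).resolve_right (Complex.exp_ne_zero _)

theorem posDef_im_two_smul (hτ : (τ.map Complex.im).PosDef) :
    (((2 : ℂ) • τ).map Complex.im).PosDef := by
  have : ((2 : ℂ) • τ).map Complex.im = (2 : ℝ) • τ.map Complex.im := by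
    ext i j
    simp
  rw [this]
  exact hτ.smul two_pos

/-- Pairs of equal parity are exactly the (p+q, p−q), and the parallelogram law separates p from q,
doubling τ. -/
theorem sum_secondTheta_zero_mul (hτ : (τ.map Complex.im).PosDef) (w : Fin g → ℂ) :
    ∑ σ, secondTheta τ 0 σ * secondTheta τ w σ =
      (∑' N, expTerm ((2 : ℂ) • τ) w N) * ∑' N, expTerm ((2 : ℂ) • τ) (-w) N := by
  have hτ2 := posDef_im_two_smul hτ
  have h := hasSum_sum (s := Finset.univ) fun σ (_ : σ ∈ Finset.univ) =>
    (summable_mul_of_summable_norm (summable_norm_residueTerm hτ 0 σ)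
      (summable_norm_residueTerm hτ w σ)).hasSum
  simp only [← tsum_mul_tsum_of_summable_norm (summable_norm_residueTerm hτ 0 _)
      (summable_norm_residueTerm hτ w _), ← secondTheta_eq_tsum] at h
  rw [← h.tsum_eq, tsum_mul_tsum_of_summable_norm (summable_norm_expTerm hτ2 w)
    (summable_norm_expTerm hτ2 (-w))]
  have hf : ∀ p : (Fin g → ℤ) × (Fin g → ℤ),
      ∑ σ, residueTerm τ 0 σ p.1 * residueTerm τ w σ p.2 =
        {p : (Fin g → ℤ) × (Fin g → ℤ) | parity p.2 = parity p.1}.indicator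
          (fun p => expTerm τ 0 p.1 * expTerm τ w p.2) p := fun p => by
    classical
    rw [Finset.sum_eq_single (parity p.1)]
    · simp [residueTerm, Set.indicator]
    · intro σ _ hσ
      simp [residueTerm, hσ.symm]
    · simp
  simp only [hf]
  have hinj : Function.Injective
      fun p : (Fin g → ℤ) × (Fin g → ℤ) => (p.1 + p.2, p.1 - p.2) := fun p q hpq => by
    simp only [Prod.mk.injEq] at hpq
    refine Prod.ext ?_ ?_ <;>
    · funext i
      have h1 := congrFun hpq.1 i
      have h2 := congrFun hpq.2 i
      simp only [Pi.add_apply, Pi.sub_apply] at h1 h2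
      omega
  rw [← hinj.tsum_eq]
  · refine tsum_congr fun p => ?_
    have hp : parity (p.1 - p.2) = parity (p.1 + p.2) := by
      funext i
      have two : (2 : ZMod 2) = 0 := rfl
      simp only [parity, Pi.add_apply, Pi.sub_apply]
      push_cast
      linear_combination -(p.2 i : ZMod 2) * two
    rw [Set.indicator_of_mem (by exact hp)]
    have e1 : (fun i => (((p.1 + p.2) i : ℤ) : ℂ)) =
        (fun i => (p.1 i : ℂ)) + fun i => (p.2 i : ℂ) := by
      funext i
      simp
    have e2 : (fun i => (((p.1 - p.2) i : ℤ) : ℂ)) =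
        (fun i => (p.1 i : ℂ)) - fun i => (p.2 i : ℂ) := by
      funext i
      simp
    simp only [expTerm, e1, e2, ← Complex.exp_add]
    simp only [Matrix.smul_mulVec, Matrix.mulVec_add, Matrix.mulVec_sub, dotProduct_smul,
      add_dotProduct, sub_dotProduct, dotProduct_add, dotProduct_sub, smul_eq_mul,
      dotProduct_zero, dotProduct_neg]
    congr 1
    ring
  · intro p hp
    have hp' : parity p.2 = parity p.1 := by
      by_contra h
      simp [h] at hp
    have hd : ∀ i, 2 ∣ p.1 i - p.2 i := fun i => by
      refine (ZMod.intCast_zmod_eq_zero_iff_dvd _ 2).1 ?_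
      have := congrFun hp' i
      simp only [parity] at this
      simp [this]
    refine ⟨(fun i => (p.1 i + p.2 i) / 2, fun i => (p.1 i - p.2 i) / 2), ?_⟩
    refine Prod.ext ?_ ?_ <;>
    · funext i
      have := hd i
      simp only [Pi.add_apply, Pi.sub_apply]
      omega

theorem tsum_expTerm_neg (w : Fin g → ℂ) :
    ∑' N, expTerm τ (-w) N = ∑' N, expTerm τ w N := by
  rw [← (Equiv.neg (Fin g → ℤ)).tsum_eq]
  refine tsum_congr fun N => ?_
  have : (fun i => (((Equiv.neg (Fin g → ℤ)) N i : ℤ) : ℂ)) = -fun i => (N i : ℂ) := by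
    funext i
    simp
  simp only [expTerm, this]
  simp [Matrix.mulVec_neg]

theorem secondTheta_zero_ne_zero (hτ : (τ.map Complex.im).PosDef) : secondTheta τ 0 ≠ 0 := by
  intro h
  have hτ2 := posDef_im_two_smul hτ
  have h0 := eq_zero_of_fourier_series_eq_zero (a := expTerm ((2 : ℂ) • τ) 0)
    (summable_norm_expTerm hτ2 0) fun x => by
      simp only [← expTerm_ofReal]
      have := sum_secondTheta_zero_mul hτ fun i => (x i : ℂ)
      rw [h, tsum_expTerm_neg] at this
      simpa using this.symm
  simpa [expTerm] using congrFun h0 0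

end

end KummerTheta

/-! ### Heisenberg averages of quartic monomials. -/

namespace KummerTheta

theorem eval_smul_of_isHomogeneous {ι R : Type*} [CommSemiring R] {P : MvPolynomial ι R} {n : ℕ}
    (hP : P.IsHomogeneous n) (c : R) (v : ι → R) :
    MvPolynomial.eval (c • v) P = c ^ n * MvPolynomial.eval v P := by
  rw [MvPolynomial.eval_eq, MvPolynomial.eval_eq, Finset.mul_sum]
  refine Finset.sum_congr rfl fun d hd => ?_
  simp only [Pi.smul_apply, smul_eq_mul, mul_pow, Finset.prod_mul_distrib,
    Finset.prod_pow_eq_pow_sum]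
  rw [← hP.degree_eq_sum_deg_support hd]
  ring

section

variable {g : ℕ}

/-- The sign `(-1)^{σ ᵗα}`. -/
noncomputable def signValue (α σ : Idx g) : ℂ := (-1 : ℂ) ^ (σ ⬝ᵥ α).val

theorem neg_one_pow_val_add (x y : ZMod 2) :
    (-1 : ℂ) ^ (x + y).val = (-1 : ℂ) ^ x.val * (-1 : ℂ) ^ y.val := by
  have h : (-1 : ℂ) ^ (x + y).val = (-1 : ℂ) ^ (x.val + y.val) := by
    rw [ZMod.val_add, neg_one_pow_eq_pow_mod_two, Nat.mod_mod, ← neg_one_pow_eq_pow_mod_two]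
  rw [h, pow_add]

theorem signValue_add_right (α σ ρ : Idx g) :
    signValue α (σ + ρ) = signValue α σ * signValue α ρ := by
  rw [signValue, add_dotProduct, neg_one_pow_val_add, signValue, signValue]

theorem signValue_add_left (α β σ : Idx g) :
    signValue (α + β) σ = signValue α σ * signValue β σ := by
  rw [signValue, dotProduct_add, neg_one_pow_val_add, signValue, signValue]

theorem sum_signValue_eq_zero {s : Idx g} (hs : s ≠ 0) : ∑ α, signValue α s = 0 := by
  obtain ⟨i, hi⟩ := Function.ne_iff.1 hs
  have hv : signValue (Pi.single i 1) s = -1 := by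
    have : s i = 1 := by
      have : ∀ x : ZMod 2, x ≠ 0 → x = 1 := by decide
      exact this _ hi
    rw [signValue, dotProduct_single, this, mul_one, ZMod.val_one, pow_one]
  -- Shifting α by a basis vector at which s is nonzero flips the sign of the sum.
  have h : ∑ α, signValue α s = ∑ α, signValue (α + Pi.single i 1) s :=
    (Fintype.sum_equiv (Equiv.addRight (Pi.single i 1)) _ _ fun _ => rfl).symm
  simp only [signValue_add_left, hv, mul_neg, mul_one, Finset.sum_neg_distrib] at h
  linear_combination h / 2

/-- Four times the difference between `P(Θ(z))` and the value predicted by Riemann's theta relation,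
as a linear form in `P`. -/
noncomputable def riemannDefect (τ : Matrix (Fin g) (Fin g) ℂ) (z : Fin g → ℂ) :
    Poly g →ₗ[ℂ] ℂ :=
  (4 : ℂ) • (MvPolynomial.aeval (secondTheta τ z)).toLinearMap -
    ∑ σ, secondTheta τ ((2 : ℂ) • z) σ •
      (MvPolynomial.aeval (secondTheta τ 0)).toLinearMap ∘ₗ (MvPolynomial.pderiv σ).toLinearMap

theorem riemannDefect_apply (τ : Matrix (Fin g) (Fin g) ℂ) (z : Fin g → ℂ) (P : Poly g) :
    riemannDefect τ z P = 4 * MvPolynomial.eval (secondTheta τ z) P -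
      ∑ σ, secondTheta τ ((2 : ℂ) • z) σ *
        MvPolynomial.eval (secondTheta τ 0) (MvPolynomial.pderiv σ P) := by
  simp [riemannDefect, LinearMap.sum_apply, MvPolynomial.aeval_eq_eval]

/-- The product rule, with the differentiated factor written first in each term to fit
`riemann_relation`. -/
theorem sum_mul_eval_pderiv_X (u v : Idx g → ℂ) (a b c d : Idx g) :
    ∑ σ, u σ * MvPolynomial.eval v (MvPolynomial.pderiv σ (MvPolynomial.X a * MvPolynomial.X b *
      (MvPolynomial.X c * MvPolynomial.X d))) =
    u a * v b * (v c * v d) + u b * v a * (v c * v d) + u c * v d * (v a * v b) +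
      u d * v c * (v a * v b) := by
  have hX : ∀ x : Idx g, ∑ σ, u σ * MvPolynomial.eval v (MvPolynomial.pderiv σ
      (MvPolynomial.X x : Poly g)) = u x := fun x => by
    classical
    rw [Finset.sum_eq_single x]
    · simp
    · intro σ _ hσ
      simp [MvPolynomial.pderiv_X_of_ne hσ.symm]
    · simp
  have hmul : ∀ p q : Poly g, ∑ σ, u σ * MvPolynomial.eval v (MvPolynomial.pderiv σ (p * q)) =
      MvPolynomial.eval v p * ∑ σ, u σ * MvPolynomial.eval v (MvPolynomial.pderiv σ q) +
      MvPolynomial.eval v q * ∑ σ, u σ * MvPolynomial.eval v (MvPolynomial.pderiv σ p) :=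
    fun p q => by
      rw [Finset.mul_sum, Finset.mul_sum, ← Finset.sum_add_distrib]
      refine Finset.sum_congr rfl fun σ _ => ?_
      simp only [Derivation.leibniz, smul_eq_mul, map_add, map_mul]
      ring
  simp only [hmul, hX, map_mul, MvPolynomial.eval_X]
  ring

theorem riemannDefect_sum_translation {τ : Matrix (Fin g) (Fin g) ℂ}
    (hτ : (τ.map Complex.im).PosDef) (z : Fin g → ℂ) {a b c d : Idx g} (h : a + b + c + d = 0) :
    riemannDefect τ z (∑ β, translation β (MvPolynomial.X a * MvPolynomial.X b *
      (MvPolynomial.X c * MvPolynomial.X d))) = 0 := by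
  simp only [map_sum, translation, map_mul, MvPolynomial.renameEquiv_apply, MvPolynomial.rename_X,
    Equiv.coe_addRight, riemannDefect_apply, sum_mul_eval_pderiv_X, MvPolynomial.eval_X,
    Finset.sum_sub_distrib, Finset.sum_add_distrib, ← Finset.mul_sum]
  rw [← riemann_relation hτ z h,
    ← riemann_relation hτ z (show b + a + c + d = 0 by rw [← h]; abel),
    ← riemann_relation hτ z (show c + d + a + b = 0 by rw [← h]; abel),
    ← riemann_relation hτ z (show d + c + a + b = 0 by rw [← h]; abel)]
  have e1 : ∀ β, secondTheta τ z (b + β) * secondTheta τ z (a + β) *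
      (secondTheta τ z (c + β) * secondTheta τ z (d + β)) =
      secondTheta τ z (a + β) * secondTheta τ z (b + β) *
      (secondTheta τ z (c + β) * secondTheta τ z (d + β)) := fun β => by ring
  have e2 : ∀ β, secondTheta τ z (c + β) * secondTheta τ z (d + β) *
      (secondTheta τ z (a + β) * secondTheta τ z (b + β)) =
      secondTheta τ z (a + β) * secondTheta τ z (b + β) *
      (secondTheta τ z (c + β) * secondTheta τ z (d + β)) := fun β => by ring
  have e3 : ∀ β, secondTheta τ z (d + β) * secondTheta τ z (c + β) *
      (secondTheta τ z (a + β) * secondTheta τ z (b + β)) =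
      secondTheta τ z (a + β) * secondTheta τ z (b + β) *
      (secondTheta τ z (c + β) * secondTheta τ z (d + β)) := fun β => by ring
  simp only [e1, e2, e3]
  ring

theorem signChange_X_mul_four (α a b c d : Idx g) :
    signChange α (MvPolynomial.X a * MvPolynomial.X b *
      (MvPolynomial.X c * MvPolynomial.X d)) =
    signValue α (a + b + c + d) • (MvPolynomial.X a * MvPolynomial.X b *
      (MvPolynomial.X c * MvPolynomial.X d) : Poly g) := by
  have h : ∀ x : Idx g, signChange α (MvPolynomial.X x) =
      MvPolynomial.C (signValue α x) * MvPolynomial.X x := fun x => by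
    change signHom α (MvPolynomial.X x) = _
    rw [signHom, MvPolynomial.aeval_X, signValue]
  rw [map_mul, map_mul, map_mul, h, h, h, h, MvPolynomial.smul_eq_C_mul, signValue_add_right,
    signValue_add_right, signValue_add_right, map_mul, map_mul, map_mul]
  ring

theorem exists_X_mul_four_of_degree_eq {ι R : Type*} [CommSemiring R] {m : ι →₀ ℕ}
    (hm : m.degree = 4) :
    ∃ a b c d, (MvPolynomial.monomial m 1 : MvPolynomial ι R) =
      MvPolynomial.X a * MvPolynomial.X b * (MvPolynomial.X c * MvPolynomial.X d) := by
  classical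
  have hcard : Multiset.card (Finsupp.toMultiset m) = 4 := by
    rw [Finsupp.card_toMultiset, ← hm]
    rfl
  obtain ⟨a, b, c, d, h⟩ := Multiset.card_eq_four.1 hcard
  refine ⟨a, b, c, d, ?_⟩
  have hm' : m = Finsupp.single a 1 + Finsupp.single b 1 +
      (Finsupp.single c 1 + Finsupp.single d 1) := by
    rw [← Finsupp.toMultiset_toFinsupp m, h]
    simp only [Multiset.insert_eq_cons, ← Multiset.singleton_add, map_add,
      Multiset.toFinsupp_singleton, add_assoc]
  rw [hm']
  simp [MvPolynomial.X, MvPolynomial.monomial_mul]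

theorem riemannDefect_average {τ : Matrix (Fin g) (Fin g) ℂ} (hτ : (τ.map Complex.im).PosDef)
    (z : Fin g → ℂ) {P : Poly g} (hP : P.IsHomogeneous 4) :
    riemannDefect τ z (∑ α, ∑ β, translation β (signChange α P)) = 0 := by
  rw [P.as_sum]
  simp only [map_sum]
  rw [Finset.sum_congr rfl fun α _ => Finset.sum_comm, Finset.sum_comm]
  refine Finset.sum_eq_zero fun m hm => ?_
  have hdeg : m.degree = 4 := by
    by_contra h
    exact (MvPolynomial.mem_support_iff.1 hm) (hP.coeff_eq_zero h)
  obtain ⟨a, b, c, d, h⟩ := exists_X_mul_four_of_degree_eq (R := ℂ) hdeg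
  have hmon : MvPolynomial.monomial m (MvPolynomial.coeff m P) =
      MvPolynomial.coeff m P • (MvPolynomial.X a * MvPolynomial.X b *
        (MvPolynomial.X c * MvPolynomial.X d) : Poly g) := by
    rw [← h, MvPolynomial.smul_monomial, smul_eq_mul, mul_one]
  simp only [hmon, map_smul, signChange_X_mul_four, ← Finset.smul_sum]
  rw [← Finset.sum_smul]
  by_cases hs : a + b + c + d = 0
  · have := riemannDefect_sum_translation hτ z hs
    rw [map_sum] at this
    rw [this, smul_zero, smul_zero]
  · rw [sum_signValue_eq_zero hs, zero_smul, smul_zero]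

/-- For a Heisenberg invariant quartic `P`, the function `P(Θ(z))` is the combination of the second
order theta functions at `2z` with coefficients the partial derivatives of `P` at `Θ(0)`. -/
theorem four_mul_eval_secondTheta {τ : Matrix (Fin g) (Fin g) ℂ}
    (hτ : (τ.map Complex.im).PosDef) {P : Poly g} (hP : P.IsHomogeneous 4)
    (hinv : IsHeisenbergInvariant P) (z : Fin g → ℂ) :
    4 * MvPolynomial.eval (secondTheta τ z) P = ∑ σ, secondTheta τ ((2 : ℂ) • z) σ *
      MvPolynomial.eval (secondTheta τ 0) (MvPolynomial.pderiv σ P) := by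
  have hsign : ∀ α, signChange α P = P := fun α =>
    hinv _ (Subgroup.subset_closure (Or.inl ⟨α, rfl⟩))
  have htrans : ∀ β, translation β P = P := fun β =>
    hinv _ (Subgroup.subset_closure (Or.inr ⟨β, rfl⟩))
  have h := riemannDefect_average hτ z hP
  -- The average of an invariant P is a nonzero multiple of P.
  simp only [hsign, htrans, Finset.sum_const, map_nsmul, smul_eq_zero, Finset.card_univ,
    Fintype.card_ne_zero, false_or, riemannDefect_apply] at h
  exact sub_eq_zero.1 h

end

end KummerTheta

theorem proposition2p5 (g : ℕ) (τ : Matrix (Fin g) (Fin g) ℂ)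
    (hτ : τ ∈ KummerTheta.SiegelUpperHalfSpace g) :
    ∃ h0 : KummerTheta.secondTheta τ 0 ≠ 0,
      ∀ P : KummerTheta.Poly g, P.IsHomogeneous 4 → KummerTheta.IsHeisenbergInvariant P →
        (KummerTheta.IsKummerEquation τ P ↔
          KummerTheta.IsSingularPoint P
            (Projectivization.mk ℂ (KummerTheta.secondTheta τ 0) h0)) := by
  refine ⟨KummerTheta.secondTheta_zero_ne_zero hτ.2, fun P hP hinv => ⟨fun h v hv hvp => ?_,
    fun h z => ?_⟩⟩
  · obtain ⟨c, hc⟩ := (Projectivization.mk_eq_mk_iff ℂ _ _ _ _).1 hvp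
    have hc' : v = (c : ℂ) • KummerTheta.secondTheta τ 0 := hc.symm
    have hd := KummerTheta.secondTheta_linearIndependent hτ.2
      (c := fun σ => MvPolynomial.eval (KummerTheta.secondTheta τ 0) (MvPolynomial.pderiv σ P))
      fun w => by
        -- Halving the argument makes 2z run over arbitrary w.
        have := KummerTheta.four_mul_eval_secondTheta hτ.2 hP hinv ((1 / 2 : ℂ) • w)
        rw [h, mul_zero, smul_smul, mul_one_div_cancel two_ne_zero, one_smul] at this
        rw [this]
        exact Finset.sum_congr rfl fun σ _ => mul_comm _ _
    refine ⟨?_, fun σ => ?_⟩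
    · rw [hc', KummerTheta.eval_smul_of_isHomogeneous hP, h 0, mul_zero]
    -- The derivatives are homogeneous too, so their vanishing does not depend on the
    -- representative.
    · rw [hc', KummerTheta.eval_smul_of_isHomogeneous hP.pderiv]
      rw [show MvPolynomial.eval (KummerTheta.secondTheta τ 0) (MvPolynomial.pderiv σ P) = 0 from
        congrFun hd σ, mul_zero]
  · have h1 := (h _ (KummerTheta.secondTheta_zero_ne_zero hτ.2) rfl).2
    have h2 := KummerTheta.four_mul_eval_secondTheta hτ.2 hP hinv z
    simp only [h1, mul_zero, Finset.sum_const_zero] at h2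
    exact (mul_eq_zero.1 h2).resolve_left (by norm_num)
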